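/- Let $c>0$ and $\dot G^+_{11},\dot G^+_{12}\in\mathbb R$, let $\epsilon_0>0$, and let $\dot v_1^+\in\mathbb R$. Put $\dot v_1^-=-\dot v_1^+$ and $\dot G^-_{1l}=-\dot G^+_{1l}$ ($l=1,2$). Let $I_+=(0,\infty)$, $I_-=(-\infty,0)$, $\Omega^\pm=\mathbb R\times I_\pm$, $\Gamma=\{x_2=0\}$, let $\dot v_1,\dot G_{1l}$ stand for $\dot v_1^\pm,\dot G^\pm_{1l}$ in $\Omega^\pm$, and let $[\phi]=\phi^+|_\Gamma-\phi^-|_\Gamma$. Consider, for real unknowns $f(t,x_1)$, $h^\pm$, $v^\pm=(v_1^\pm,v_2^\pm)$, $G_l^\pm=(G^\pm_{1l},G^\pm_{2l})$, $l=1,2$, the linearized system $$\begin{cases}\partial_t h+\dot v_1\partial_1h+\operatorname{div}v=0 & \text{in }\Omega^\pm,\\ \partial_tv+\dot v_1\partial_1v+c^2\nabla h=\sum_{l=1}^2\dot G_{1l}\,\partial_1G_l & \text{in }\Omega^\pm,\\ \partial_tG_l+\dot v_1\partial_1G_l=\dot G_{1l}\,\partial_1v & \text{in }\Omega^\pm,\\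 \partial_tf=v_2-\dot v_1\partial_1f & \text{on }\Gamma,\\ [h]=0,\quad [v_2]=2\dot v_1^+\partial_1f,\quad G_{2l}-\dot G_{1l}\,\partial_1f=0 & \text{on }\Gamma,\end{cases}$$ where the fourth and the last equation on $\Gamma$ hold for the traces from both sides. With $\hat\psi(\eta)=\int_{\mathbb R}\psi\,e^{-ix_1\eta}\,dx_1$ put, for $m\in\mathbb N$, $\|f\|_{H^m(\Gamma)}^2=\int_{\mathbb R}(1+\eta^2)^m|\hat f|^2\,d\eta$, $\|\psi\|_{H^m(\Omega)}^2=\sum_{\pm}\sum_{s=0}^m\int_{\mathbb R}\int_{I_\pm}(1+\eta^2)^{m-s}|\partial_2^s\hat\psi^\pm(\eta,x_2)|^2\,dx_2\,d\eta$ (for vectors, the squares of the components are added), and $\|(f,h,v,G_l)\|_{H^m}=\|f\|_{H^m(\Gamma)}+\|h\|_{H^m(\Omega)}+\|v\|_{H^m(\Omega)}+\|G_l\|_{H^m(\Omega)}$. Suppose that the Mach number $M=|\dot v_1^+|/c$ satisfies $$\sqrt{\tfrac{(\dot G_{11}^+)^2+(\dot G_{12}^+)^2}{c^2}}+\epsilon_0\le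 M\le\sqrt{2+\tfrac{(\dot G_{11}^+)^2+(\dot G_{12}^+)^2}{c^2}}-\epsilon_0 .$$ Then the system is Hadamard ill-posed in $H^k$ for every $k\in\mathbb N$, in the following sense. For every $j\in\mathbb N$ there is a constant $C>0$, depending only on $c,\dot G^+_{11},\dot G^+_{12},\epsilon_0,j$, such that for all $k\in\mathbb N$ with $k\le j$, all $T_0>0$ and all $\alpha>0$ there is a sequence $(f_n,h_n,v_n,G_{n,1},G_{n,2})_{n\ge1}$ of solutions on $t\ge0$, smooth up to $t=0$ and up to $\Gamma$ and with values in $H^m$ for every $m$, such that for all $n\ge1$ and $l=1,2$ $$\|(f_n,h_n,v_n,G_{n,l})(0)\|_{H^j}\le\frac Cn,\qquad \|(f_n,h_n,v_n,G_{n,l})(t)\|_{H^k}\ge\alpha\quad\text{for all }t\ge T_0 .$$ Moreover, with $X_1=\Big(\sqrt{c^4+4\big((\dot G_{11}^+)^2+(\dot G_{12}^+)^2+c^2\big)(\dot v_1^+)^2}-(\dot v_1^+)^2-(\dot G_{11}^+)^2-(\dot G_{12}^+)^2-c^2\Big)^{1/2}$, for all sufficiently large $n$ the solutions are superpositions of normal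 modes: $\hat f_n(t,\eta)=e^{X_1|\eta|t}\chi_n(\eta)$ with a smooth real function $\chi_n$ that vanishes unless $n\le|\eta|\le n+1$, and the horizontal Fourier transform of each component of $h_n,v_n,G_{n,l}$ at time $t\ge0$ equals $e^{X_1|\eta|t}$ times its value at time $0$ and vanishes unless $n\le|\eta|\le n+1$. -/

import Mathlib

open scoped ContDiff ENNReal

namespace KelvinHelmholtz

/-- The two sides of the flat interface `Γ = {x₂ = 0}`. -/
inductive Side where
  | upper
  | lower

/-- `+1` on the upper side and `-1` on the lower side. -/
def Side.sign : Side → ℝ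
  | .upper => 1
  | .lower => -1

/-- The open half-line `I₊ = (0, ∞)` or `I₋ = (-∞, 0)`; `Ω± = ℝ × I±`. -/
def Side.halfLine : Side → Set ℝ
  | .upper => Set.Ioi 0
  | .lower => Set.Iio 0

/-- The closed half-line `[0, ∞)` or `(-∞, 0]`. -/
def Side.closedHalfLine : Side → Set ℝ
  | .upper => Set.Ici 0
  | .lower => Set.Iic 0

/-- The unknowns of the linearized problem. The front is `f t x₁`. The bulk unknowns are given
separately on each side, as functions of `t x₁ x₂`, so that both traces on `Γ` make sense:
`h s` is the pressure unknown, `v s i` the `i`-th velocity component, and `G s i l` the entry in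
row `i` and column `l` of the deformation unknown. The indices `0, 1 : Fin 2` stand for `1, 2`.
Only the values for `t ≥ 0` and `x₂` in the closed half-line of `s` matter. -/
structure Fields where
  f : ℝ → ℝ → ℝ
  h : Side → ℝ → ℝ → ℝ → ℝ
  v : Side → Fin 2 → ℝ → ℝ → ℝ → ℝ
  G : Side → Fin 2 → Fin 2 → ℝ → ℝ → ℝ → ℝ

/-- `∂ₜ` of a function of `(t, x₁, x₂)`. -/
noncomputable def dt (φ : ℝ → ℝ → ℝ → ℝ) (t x₁ x₂ : ℝ) : ℝ := deriv (fun r => φ r x₁ x₂) t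

/-- `∂₁` of a function of `(t, x₁, x₂)`. -/
noncomputable def d1 (φ : ℝ → ℝ → ℝ → ℝ) (t x₁ x₂ : ℝ) : ℝ := deriv (fun r => φ t r x₂) x₁

/-- `∂₂` of a function of `(t, x₁, x₂)`. -/
noncomputable def d2 (φ : ℝ → ℝ → ℝ → ℝ) (t x₁ x₂ : ℝ) : ℝ := deriv (fun r => φ t x₁ r) x₂

/-- The horizontal Fourier transform `∫ φ(x₁) e^{-i x₁ η} dx₁`. -/
noncomputable def fourier1 (φ : ℝ → ℝ) (η : ℝ) : ℂ :=
  ∫ x : ℝ, (φ x : ℂ) * Complex.exp (-(Complex.I * (x : ℂ) * (η : ℂ)))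

/-- The horizontal Fourier transform of a function of `(x₁, x₂)`. -/
noncomputable def partialFourier (ψ : ℝ → ℝ → ℝ) (η x₂ : ℝ) : ℂ :=
  fourier1 (fun x₁ => ψ x₁ x₂) η

/-- The squared norm of `H^m(Γ)`. -/
noncomputable def sobolevSqFront (m : ℕ) (φ : ℝ → ℝ) : ℝ≥0∞ :=
  ∫⁻ η : ℝ, ENNReal.ofReal ((1 + η ^ 2) ^ m) * ‖fourier1 φ η‖ₑ ^ 2

/-- The squared norm of `H^m(Ω±)`:
`∑_{r ≤ m} ∫_ℝ ∫_{I±} (1 + η²)^{m - r} |∂₂^r ψ̂(η, x₂)|² dx₂ dη`. -/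
noncomputable def sobolevSqSide (s : Side) (m : ℕ) (ψ : ℝ → ℝ → ℝ) : ℝ≥0∞ :=
  ∑ r ∈ Finset.range (m + 1), ∫⁻ η : ℝ, ∫⁻ x₂ in s.halfLine,
    ENNReal.ofReal ((1 + η ^ 2) ^ (m - r)) *
      ‖iteratedDeriv r (fun y => partialFourier ψ η y) x₂‖ₑ ^ 2

/-- The squared norm of the piecewise Sobolev space `H^m(Ω)`. -/
noncomputable def sobolevSqBulk (m : ℕ) (ψ : Side → ℝ → ℝ → ℝ) : ℝ≥0∞ :=
  sobolevSqSide .upper m (ψ .upper) + sobolevSqSide .lower m (ψ .lower)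

/-- `‖(f, h, v, G_l)(t)‖_{H^m} = ‖f‖_{H^m(Γ)} + ‖h‖_{H^m(Ω)} + ‖v‖_{H^m(Ω)} + ‖G_l‖_{H^m(Ω)}`,
where `G_l` is the `l`-th column of `G`. -/
noncomputable def Fields.sobolevNorm (U : Fields) (m : ℕ) (l : Fin 2) (t : ℝ) : ℝ≥0∞ :=
  sobolevSqFront m (U.f t) ^ (1 / 2 : ℝ)
    + sobolevSqBulk m (fun s => U.h s t) ^ (1 / 2 : ℝ)
    + (∑ i, sobolevSqBulk m (fun s => U.v s i t)) ^ (1 / 2 : ℝ)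
    + (∑ i, sobolevSqBulk m (fun s => U.G s i l t)) ^ (1 / 2 : ℝ)

/-- Smoothness up to `t = 0` and up to the interface, together with the properties that make the
horizontal Fourier transform of `φ` and its `x₂`-derivatives genuine at every time `t ≥ 0`. -/
structure IsRegularBulk (s : Side) (φ : ℝ → ℝ → ℝ → ℝ) : Prop where
  smooth : ContDiffOn ℝ ∞ (fun p : ℝ × ℝ × ℝ => φ p.1 p.2.1 p.2.2)
    (Set.Ici 0 ×ˢ (Set.univ ×ˢ s.closedHalfLine))
  integrable : ∀ t, 0 ≤ t → ∀ x₂ ∈ s.halfLine,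
    MeasureTheory.Integrable (fun x₁ => φ t x₁ x₂)
  smooth_fourier : ∀ t, 0 ≤ t → ∀ η : ℝ,
    ContDiffOn ℝ ∞ (fun x₂ => partialFourier (φ t) η x₂) s.halfLine

/-- The same for a function on `Γ`. -/
structure IsRegularFront (φ : ℝ → ℝ → ℝ) : Prop where
  smooth : ContDiffOn ℝ ∞ (fun p : ℝ × ℝ => φ p.1 p.2) (Set.Ici 0 ×ˢ Set.univ)
  integrable : ∀ t, 0 ≤ t → MeasureTheory.Integrable (φ t)

/-- Smooth real solutions, on `t ≥ 0` and with values in every `H^m`, of the linearized system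
around the rectilinear flow with sound speed `c`, horizontal velocity `±V` in `Ω±` and first row
`±(B 0, B 1)` of the deformation gradient in `Ω±` (its second row is zero). -/
structure IsSolution (c V : ℝ) (B : Fin 2 → ℝ) (U : Fields) : Prop where
  regular_f : IsRegularFront U.f
  regular_h : ∀ s, IsRegularBulk s (U.h s)
  regular_v : ∀ s i, IsRegularBulk s (U.v s i)
  regular_G : ∀ s i l, IsRegularBulk s (U.G s i l)
  finite_norm : ∀ (m : ℕ) (l : Fin 2) (t : ℝ), 0 ≤ t → U.sobolevNorm m l t < ⊤
  /-- `∂ₜ h + v̇₁ ∂₁ h + div v = 0` in `Ω±`. -/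
  mass : ∀ s t x₁ x₂, 0 < t → x₂ ∈ s.halfLine →
    dt (U.h s) t x₁ x₂ + s.sign * V * d1 (U.h s) t x₁ x₂
      + (d1 (U.v s 0) t x₁ x₂ + d2 (U.v s 1) t x₁ x₂) = 0
  /-- First component of `∂ₜ v + v̇₁ ∂₁ v + c² ∇h = ∑ₗ Ġ₁ₗ ∂₁ Gₗ` in `Ω±`. -/
  momentum_one : ∀ s t x₁ x₂, 0 < t → x₂ ∈ s.halfLine →
    dt (U.v s 0) t x₁ x₂ + s.sign * V * d1 (U.v s 0) t x₁ x₂ + c ^ 2 * d1 (U.h s) t x₁ x₂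
      = ∑ l, s.sign * B l * d1 (U.G s 0 l) t x₁ x₂
  /-- Second component of the same equation. -/
  momentum_two : ∀ s t x₁ x₂, 0 < t → x₂ ∈ s.halfLine →
    dt (U.v s 1) t x₁ x₂ + s.sign * V * d1 (U.v s 1) t x₁ x₂ + c ^ 2 * d2 (U.h s) t x₁ x₂
      = ∑ l, s.sign * B l * d1 (U.G s 1 l) t x₁ x₂
  /-- `∂ₜ Gₗ + v̇₁ ∂₁ Gₗ = Ġ₁ₗ ∂₁ v` in `Ω±`. -/
  deformation : ∀ s i l t x₁ x₂, 0 < t → x₂ ∈ s.halfLine →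
    dt (U.G s i l) t x₁ x₂ + s.sign * V * d1 (U.G s i l) t x₁ x₂
      = s.sign * B l * d1 (U.v s i) t x₁ x₂
  /-- `∂ₜ f = v₂ - v̇₁ ∂₁ f` on `Γ`, for the traces from both sides. -/
  front : ∀ s t x₁, 0 < t →
    deriv (fun r => U.f r x₁) t = U.v s 1 t x₁ 0 - s.sign * V * deriv (U.f t) x₁
  /-- `[h] = 0` on `Γ`. -/
  jump_h : ∀ t x₁, 0 ≤ t → U.h .upper t x₁ 0 - U.h .lower t x₁ 0 = 0
  /-- `[v · e₂] = 2 v̇₁⁺ ∂₁ f` on `Γ`. -/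
  jump_v : ∀ t x₁, 0 ≤ t →
    U.v .upper 1 t x₁ 0 - U.v .lower 1 t x₁ 0 = 2 * V * deriv (U.f t) x₁
  /-- `G₂ₗ - Ġ₁ₗ ∂₁ f = 0` on `Γ`, for the traces from both sides. -/
  boundary_G : ∀ s l t x₁, 0 ≤ t →
    U.G s 1 l t x₁ 0 - s.sign * B l * deriv (U.f t) x₁ = 0

/-- The growth rate `X₁`, that is
`X₁² = √(c⁴ + 4 (|B|² + c²) V²) - V² - |B|² - c²`. -/
noncomputable def growthRate (c V : ℝ) (B : Fin 2 → ℝ) : ℝ :=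
  √(√(c ^ 4 + 4 * (B 0 ^ 2 + B 1 ^ 2 + c ^ 2) * V ^ 2) - V ^ 2 - (B 0 ^ 2 + B 1 ^ 2) - c ^ 2)

/-- Every horizontal Fourier mode of `φ` evolves by the factor `e^{X |η| t}`, and only the modes
with `n ≤ |η| ≤ n + 1` are present. -/
def IsNormalModeBulk (X : ℝ) (n : ℕ) (s : Side) (φ : ℝ → ℝ → ℝ → ℝ) : Prop :=
  ∀ t η x₂ : ℝ, 0 ≤ t → x₂ ∈ s.halfLine →
    partialFourier (φ t) η x₂ = (Real.exp (X * |η| * t) : ℂ) * partialFourier (φ 0) η x₂ ∧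
    (partialFourier (φ t) η x₂ ≠ 0 → (n : ℝ) ≤ |η| ∧ |η| ≤ n + 1)

/-- A superposition of growing normal modes with rate `X |η|` and frequencies in
`n ≤ |η| ≤ n + 1`; the Fourier data of the front are a smooth real function `χ`. -/
structure IsNormalModeSuperposition (X : ℝ) (n : ℕ) (U : Fields) : Prop where
  front : ∃ χ : ℝ → ℝ, ContDiff ℝ ∞ χ ∧
    (∀ η, χ η ≠ 0 → (n : ℝ) ≤ |η| ∧ |η| ≤ n + 1) ∧
    ∀ t η : ℝ, 0 ≤ t → fourier1 (U.f t) η = (Real.exp (X * |η| * t) : ℂ) * (χ η : ℂ)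
  bulk_h : ∀ s, IsNormalModeBulk X n s (U.h s)
  bulk_v : ∀ s i, IsNormalModeBulk X n s (U.v s i)
  bulk_G : ∀ s i l, IsNormalModeBulk X n s (U.G s i l)

end KelvinHelmholtz

/-!
For a profile `χ` supported in the band `[n, n + 1]`, the function
`F(z) = ∫ χ(η) e^{η z} dη` (`laplace χ`) is entire, with derivative the transform of `η χ(η)`.
Let `s = ±1` be the sign of the side. If `m` is complex with `Re m > 0`, then
`Re (A F'(X t + i x₁ - s m x₂))` is a superposition of normal modes growing like `e^{X |η| t}` and
decaying away from the interface. Every first derivative of such a field is `Re (A' F'')` at the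
same point, with `A'` a multiple of `A`, so the linearized system reduces to algebraic identities
between amplitudes. With `d = X + i s V` and `m = p + i s q`, the amplitudes are `1` for `f` (with
`F` in place of `F'`), `2 i q` for `h`, `-i s d m̄` and `d` for the components of `v`, and `B_l m̄`
and `i s B_l` for those of the `l`-th column of `G`. They solve the system when `|m| = 1` and
`d² + |B|² = c² (m² - 1)`, that is `Dispersion`. Eliminating `m` leaves
`(X² - V² + |B|² + c²)² + 4 X² V² = c⁴`, whose positive root is `growthRate`; it exists precisely
when `|B|² < V² < |B|² + 2 c²`, which the bounds on the Mach number guarantee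
(`exists_dispersion`).

Fourier inversion on vertical lines (`fourier1_re_laplace`) gives the horizontal Fourier transforms
explicitly, hence an upper bound of every `H^m` norm at time `0` by the amplitude of `χ` times a
polynomial in `n` (`sobolevNorm_normalModeFields_le`), while the front alone grows like `e^{X n t}`
(`le_sobolevNorm_normalModeFields`). Taking the amplitude to be `1 / n` times the inverse of that
polynomial makes the data at most `1 / n` in `H^j`, and for large `n` the exponential beats the
polynomial uniformly for `t ≥ T₀`. In particular `C = 1` works.
-/

open scoped ContDiff ENNReal

namespace KelvinHelmholtz

open MeasureTheory Complex FourierTransform ComplexConjugate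

/-! ### The Laplace transform of a compactly supported profile -/

/-- The two-sided Laplace transform `∫ χ(η) e^{η z} dη`, in the sign convention of a moment
generating function. -/
noncomputable def laplace (χ : ℝ → ℝ) (z : ℂ) : ℂ := ∫ η : ℝ, (χ η : ℂ) * exp (η * z)

theorem hasDerivAt_laplace {χ : ℝ → ℝ} (hχ : Continuous χ) (hc : HasCompactSupport χ) (z : ℂ) :
    HasDerivAt (laplace χ) (laplace (fun η => η * χ η) z) z := by
  have hcont (w : ℂ) : Continuous fun η : ℝ => (χ η : ℂ) * exp (η * w) := by fun_prop
  have hcont' (w : ℂ) : Continuous fun η : ℝ => ((η * χ η : ℝ) : ℂ) * exp (η * w) := by fun_prop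
  have hsupp (w : ℂ) : HasCompactSupport fun η : ℝ => (χ η : ℂ) * exp (η * w) :=
    (hc.comp_left (g := ((↑) : ℝ → ℂ)) ofReal_zero).mul_right
  refine (hasDerivAt_integral_of_dominated_loc_of_deriv_le (μ := volume)
    (F := fun w (η : ℝ) => (χ η : ℂ) * exp (η * w))
    (F' := fun w (η : ℝ) => ((η * χ η : ℝ) : ℂ) * exp (η * w))
    (bound := fun η => |η * χ η| * Real.exp (|η| * (‖z‖ + 1)))
    (Metric.ball_mem_nhds z one_pos)
    (.of_forall fun w => (hcont w).aestronglyMeasurable)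
    ((hcont z).integrable_of_hasCompactSupport (hsupp z)) (hcont' z).aestronglyMeasurable
    (.of_forall fun η w hw => ?_) ?_ (.of_forall fun η w _ => ?_)).2
  · rw [norm_mul, norm_real, Real.norm_eq_abs, norm_exp]
    have hw1 : ‖w‖ ≤ ‖z‖ + 1 := by
      have h1 : ‖w - z‖ < 1 := by simpa [dist_eq_norm] using hw
      linarith [norm_sub_norm_le w z]
    gcongr
    calc ((η : ℂ) * w).re ≤ ‖(η : ℂ) * w‖ := re_le_norm _
      _ = |η| * ‖w‖ := by rw [norm_mul, norm_real, Real.norm_eq_abs]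
      _ ≤ _ := by gcongr
  · refine Continuous.integrable_of_hasCompactSupport (by fun_prop) ?_
    exact ((hc.mul_left (f := fun η => η)).comp_left (g := fun y : ℝ => |y|) abs_zero).mul_right
  · have h := (((hasDerivAt_id w).const_mul (η : ℂ)).cexp).const_mul (χ η : ℂ)
    refine h.congr_deriv ?_
    simp only [id, ofReal_mul]
    ring

theorem contDiff_laplace {χ : ℝ → ℝ} (hχ : Continuous χ) (hc : HasCompactSupport χ) :
    ContDiff ℝ ∞ (laplace χ) := by
  have h : Differentiable ℂ (laplace χ) := fun z =>
    (hasDerivAt_laplace hχ hc z).differentiableAt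
  exact (h.contDiff (n := ∞)).restrict_scalars ℝ

/-- On a vertical line, `laplace χ` is a rescaled inverse Fourier transform. -/
theorem laplace_vertical (χ : ℝ → ℝ) (z : ℂ) (x : ℝ) :
    laplace χ (z + I * x)
      = 𝓕⁻ (fun η : ℝ => (χ η : ℂ) * exp (η * z)) (x / (2 * Real.pi)) := by
  rw [Real.fourierInv_eq', laplace]
  congr 1 with η
  have : (η : ℂ) * (z + I * x)
      = ((2 * Real.pi * inner ℝ η (x / (2 * Real.pi)) : ℝ) : ℂ) * I + η * z := by
    have : (Real.pi : ℂ) ≠ 0 := by exact_mod_cast Real.pi_ne_zero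
    simp
    field_simp
    ring
  rw [this, exp_add, smul_eq_mul]
  ring

/-- The compact support of `χ` absorbs the growth of the exponential. -/
theorem exists_schwartzMap_mul_exp {χ : ℝ → ℝ} (hχ : ContDiff ℝ ∞ χ)
    (hc : HasCompactSupport χ) (z : ℂ) :
    ∃ g : SchwartzMap ℝ ℂ, ∀ η : ℝ, g η = (χ η : ℂ) * exp (η * z) := by
  have h1 : HasCompactSupport fun η : ℝ => (χ η : ℂ) * exp (η * z) :=
    (hc.comp_left (g := ((↑) : ℝ → ℂ)) ofReal_zero).mul_right
  have h2 : ContDiff ℝ ∞ fun η : ℝ => (χ η : ℂ) * exp (η * z) := by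
    have h3 : ContDiff ℝ ∞ fun η : ℝ => (η : ℂ) := ofRealCLM.contDiff
    have h4 : ContDiff ℝ ∞ fun η : ℝ => (χ η : ℂ) := ofRealCLM.contDiff.comp hχ
    exact h4.mul ((h3.mul contDiff_const).cexp)
  exact ⟨h1.toSchwartzMap h2, fun η => rfl⟩

theorem integrable_laplace_vertical {χ : ℝ → ℝ} (hχ : ContDiff ℝ ∞ χ)
    (hc : HasCompactSupport χ) (z : ℂ) :
    Integrable fun x : ℝ => laplace χ (z + I * x) := by
  obtain ⟨g, hg⟩ := exists_schwartzMap_mul_exp hχ hc z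
  have h : Integrable (𝓕⁻ (g : ℝ → ℂ)) := by
    rw [← SchwartzMap.fourierInv_coe]
    exact (𝓕⁻ g).integrable
  have hg' : (fun η : ℝ => (χ η : ℂ) * exp (η * z)) = g := (funext hg).symm
  simp_rw [laplace_vertical, hg']
  exact h.comp_div (by positivity)

/-- Fourier inversion along a vertical line. -/
theorem integral_laplace_vertical {χ : ℝ → ℝ} (hχ : ContDiff ℝ ∞ χ)
    (hc : HasCompactSupport χ) (z : ℂ) (η : ℝ) :
    ∫ x : ℝ, laplace χ (z + I * x) * exp (-(I * x * η))
      = 2 * Real.pi * (χ η * exp (η * z)) := by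
  obtain ⟨g, hg⟩ := exists_schwartzMap_mul_exp hχ hc z
  have hg' : (fun η : ℝ => (χ η : ℂ) * exp (η * z)) = g := (funext hg).symm
  have hinv : 𝓕 (𝓕⁻ (g : ℝ → ℂ)) = g := by
    rw [← SchwartzMap.fourierInv_coe, ← SchwartzMap.fourier_coe,
      FourierTransform.fourier_fourierInv_eq]
  have h1 := congrFun hinv η
  rw [Real.fourier_eq'] at h1
  have h2 := Measure.integral_comp_div
    (fun y : ℝ => exp (((-2 * Real.pi * inner ℝ y η : ℝ) : ℂ) * I) • 𝓕⁻ (g : ℝ → ℂ) y) (2 * Real.pi)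
  rw [h1] at h2
  rw [← hg, ← ofReal_ofNat, ← ofReal_mul, ← real_smul]
  rw [abs_of_pos (by positivity)] at h2
  rw [← h2]
  congr 1 with x
  rw [laplace_vertical, hg', smul_eq_mul, mul_comm]
  congr 2
  have : (Real.pi : ℂ) ≠ 0 := by exact_mod_cast Real.pi_ne_zero
  simp
  field_simp

/-- The conjugate in the second term accounts for the negative frequencies of a real function. -/
theorem fourier1_re_laplace {χ : ℝ → ℝ} (hχ : ContDiff ℝ ∞ χ) (hc : HasCompactSupport χ)
    (A z : ℂ) (η : ℝ) :
    fourier1 (fun x => (A * laplace χ (z + I * x)).re) η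
      = Real.pi * (A * (χ η * exp (η * z)) + conj A * (χ (-η) * exp (-η * conj z))) := by
  have hint (η : ℝ) : Integrable fun x : ℝ => laplace χ (z + I * x) * exp (-(I * x * η)) := by
    have h : (fun x : ℝ => -(I * x * η)) = fun x : ℝ => ((-(x * η) : ℝ) : ℂ) * I := by
      ext x; push_cast; ring
    refine (integrable_laplace_vertical hχ hc z).mul_bdd (c := 1) (by fun_prop)
      (.of_forall fun x => ?_)
    rw [congrFun h x, norm_exp_ofReal_mul_I]
  have hconj : ∫ x : ℝ, conj (laplace χ (z + I * x)) * exp (-(I * x * η))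
      = conj (2 * Real.pi * (χ (-η) * exp (((-η : ℝ) : ℂ) * z))) := by
    rw [← integral_laplace_vertical hχ hc, ← integral_conj]
    congr 1 with x
    simp [← exp_conj]
  have hint' : Integrable fun x : ℝ => conj (laplace χ (z + I * x)) * exp (-(I * x * η)) := by
    refine ((conjCLE : ℂ →L[ℝ] ℂ).integrable_comp (hint (-η))).congr (.of_forall fun x => ?_)
    simp [← exp_conj]
  calc fourier1 (fun x => (A * laplace χ (z + I * x)).re) η
      = ∫ x : ℝ, (A / 2 * (laplace χ (z + I * x) * exp (-(I * x * η)))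
          + conj A / 2 * (conj (laplace χ (z + I * x)) * exp (-(I * x * η)))) := by
        rw [fourier1]
        congr 1 with x
        rw [re_eq_add_conj, map_mul]
        ring
    _ = _ := by
        rw [integral_add ((hint η).const_mul _) (hint'.const_mul _), integral_const_mul,
          integral_const_mul, integral_laplace_vertical hχ hc, hconj]
        simp [← exp_conj, map_ofNat]
        ring

/-! ### Band-limited superpositions of normal modes -/

/-- The real field `Re (A F(X t + i x₁ - m x₂))` with `F = laplace χ`: a superposition, with weight
`χ(η)`, of the modes `A e^{η (X t + i x₁ - m x₂)}`. The sign of the side is part of `m`. -/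
noncomputable def mode (χ : ℝ → ℝ) (X : ℝ) (A m : ℂ) (t x₁ x₂ : ℝ) : ℝ :=
  (A * laplace χ (X * t + I * x₁ - m * x₂)).re

/-- A smooth profile bounded by `a` and supported in the positive frequency band `[n, n + 1]`. Taking
the real part in `mode` supplies the reflected negative band. -/
structure IsBandProfile (n : ℕ) (a : ℝ) (χ : ℝ → ℝ) : Prop where
  smooth : ContDiff ℝ ∞ χ
  band : ∀ η, χ η ≠ 0 → (n : ℝ) ≤ η ∧ η ≤ n + 1
  bound : ∀ η, |χ η| ≤ a

namespace IsBandProfile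

variable {n : ℕ} {a : ℝ} {χ : ℝ → ℝ}

theorem hasCompactSupport (h : IsBandProfile n a χ) : HasCompactSupport χ :=
  HasCompactSupport.intro (K := Set.Icc (n : ℝ) (n + 1)) isCompact_Icc fun η hη => by
    by_contra h0
    exact hη (h.band η h0)

theorem id_mul (h : IsBandProfile n a χ) :
    IsBandProfile n ((n + 1) * a) (fun η => η * χ η) where
  smooth := contDiff_id.mul h.smooth
  band η hη := h.band η (right_ne_zero_of_mul hη)
  bound η := by
    have ha : 0 ≤ a := (abs_nonneg _).trans (h.bound 0)
    by_cases h0 : χ η = 0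
    · simp only [h0, mul_zero, abs_zero]; positivity
    · have h1 := h.band η h0
      have h2 : 0 ≤ η := (Nat.cast_nonneg n).trans h1.1
      rw [abs_mul, abs_of_nonneg h2]
      exact mul_le_mul h1.2 (h.bound η) (abs_nonneg _) (by positivity)

end IsBandProfile

section Calculus

variable {n : ℕ} {a : ℝ} {χ : ℝ → ℝ} (h : IsBandProfile n a χ) (X : ℝ) (A m : ℂ)
include h

theorem contDiff_mode :
    ContDiff ℝ ∞ fun p : ℝ × ℝ × ℝ => mode χ X A m p.1 p.2.1 p.2.2 := by
  have h1 := contDiff_laplace h.smooth.continuous h.hasCompactSupport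
  have h2 : ContDiff ℝ ∞ fun p : ℝ × ℝ × ℝ =>
      (X * p.1 + I * p.2.1 - m * p.2.2 : ℂ) := by
    have e1 : ContDiff ℝ ∞ fun p : ℝ × ℝ × ℝ => (p.1 : ℂ) := ofRealCLM.contDiff.comp contDiff_fst
    have e2 : ContDiff ℝ ∞ fun p : ℝ × ℝ × ℝ => (p.2.1 : ℂ) :=
      ofRealCLM.contDiff.comp (contDiff_fst.comp contDiff_snd)
    have e3 : ContDiff ℝ ∞ fun p : ℝ × ℝ × ℝ => (p.2.2 : ℂ) :=
      ofRealCLM.contDiff.comp (contDiff_snd.comp contDiff_snd)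
    fun_prop
  exact reCLM.contDiff.comp (contDiff_const.mul (h1.comp h2))

theorem hasDerivAt_re_laplace {g : ℝ → ℂ} {g' : ℂ} {r : ℝ} (hg : HasDerivAt g g' r) :
    HasDerivAt (fun r => (A * laplace χ (g r)).re)
      (A * g' * laplace (fun η => η * χ η) (g r)).re r := by
  have h1 := (hasDerivAt_laplace h.smooth.continuous h.hasCompactSupport (g r)).comp r hg
  refine (reCLM.hasFDerivAt.comp_hasDerivAt r (h1.const_mul A)).congr_deriv ?_
  simp only [reCLM_apply]
  congr 1
  ring

theorem dt_mode (t x₁ x₂ : ℝ) :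
    dt (mode χ X A m) t x₁ x₂ = mode (fun η => η * χ η) X (A * X) m t x₁ x₂ := by
  refine (hasDerivAt_re_laplace h A (g := fun r : ℝ => (X * r + I * x₁ - m * x₂ : ℂ)) ?_).deriv
  simpa using (((hasDerivAt_id t).ofReal_comp.const_mul (X : ℂ)).add_const (I * x₁)).sub_const
    (m * x₂)

theorem d1_mode (t x₁ x₂ : ℝ) :
    d1 (mode χ X A m) t x₁ x₂ = mode (fun η => η * χ η) X (A * I) m t x₁ x₂ := by
  refine (hasDerivAt_re_laplace h A (g := fun r : ℝ => (X * t + I * r - m * x₂ : ℂ)) ?_).deriv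
  simpa using (((hasDerivAt_id x₁).ofReal_comp.const_mul I).const_add (X * t : ℂ)).sub_const
    (m * x₂)

theorem d2_mode (t x₁ x₂ : ℝ) :
    d2 (mode χ X A m) t x₁ x₂ = mode (fun η => η * χ η) X (A * -m) m t x₁ x₂ := by
  refine (hasDerivAt_re_laplace h A (g := fun r : ℝ => (X * t + I * x₁ - m * r : ℂ)) ?_).deriv
  simpa using ((hasDerivAt_id x₂).ofReal_comp.const_mul m).const_sub (X * t + I * x₁ : ℂ)

theorem integrable_mode (t x₂ : ℝ) : Integrable fun x₁ => mode χ X A m t x₁ x₂ := by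
  refine (((integrable_laplace_vertical h.smooth h.hasCompactSupport
    (X * t - m * x₂)).const_mul A).re).congr (.of_forall fun x => ?_)
  simp only [mode, RCLike.re_to_complex]
  congr 3
  ring

theorem partialFourier_mode (t η y : ℝ) :
    partialFourier (mode χ X A m t) η y
      = Real.pi * A * χ η * Real.exp (X * η * t) * exp (-(η * m) * y)
        + Real.pi * conj A * χ (-η) * Real.exp (X * -η * t) * exp (η * conj m * y) := by
  have h1 := fourier1_re_laplace h.smooth h.hasCompactSupport A (X * t - m * y) η
  have h2 : (fun x : ℝ => (A * laplace χ (X * t - m * y + I * x)).re)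
      = fun x => mode χ X A m t x y := by
    ext x
    rw [mode]
    congr 3
    ring
  have e1 : exp (η * (X * t - m * y)) = Real.exp (X * η * t) * exp (-(η * m) * y) := by
    rw [ofReal_exp, ← exp_add]
    congr 1
    push_cast
    ring
  have e2 : exp (-η * conj (X * t - m * y : ℂ))
      = Real.exp (X * -η * t) * exp (η * conj m * y) := by
    rw [ofReal_exp, ← exp_add]
    congr 1
    simp only [map_sub, map_mul, conj_ofReal]
    push_cast
    ring
  rw [partialFourier, ← h2, h1, e1, e2]
  ring

omit h in
theorem iteratedDeriv_add_exp (α β a b : ℂ) (r : ℕ) :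
    iteratedDeriv r (fun y : ℝ => α * exp (a * y) + β * exp (b * y))
      = fun y : ℝ => α * a ^ r * exp (a * y) + β * b ^ r * exp (b * y) := by
  induction r with
  | zero => simp
  | succ r ih =>
    have hd (γ d : ℂ) (y : ℝ) :
        HasDerivAt (fun y : ℝ => γ * exp (d * y)) (γ * d * exp (d * y)) y := by
      refine ((((hasDerivAt_id y).ofReal_comp.const_mul d).cexp).const_mul γ).congr_deriv ?_
      simp only [id, ofReal_one]
      ring
    rw [iteratedDeriv_succ, ih]
    ext y
    rw [((hd _ _ y).fun_add (hd _ _ y)).deriv]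
    ring

theorem iteratedDeriv_partialFourier_mode (t η : ℝ) (r : ℕ) (y : ℝ) :
    iteratedDeriv r (fun y => partialFourier (mode χ X A m t) η y) y
      = Real.pi * A * χ η * Real.exp (X * η * t) * (-(η * m)) ^ r * exp (-(η * m) * y)
        + Real.pi * conj A * χ (-η) * Real.exp (X * -η * t) * (η * conj m) ^ r
          * exp (η * conj m * y) := by
  simp_rw [partialFourier_mode h]
  rw [iteratedDeriv_add_exp]

theorem isRegularBulk_mode (s : Side) : IsRegularBulk s (mode χ X A m) where
  smooth := (contDiff_mode h X A m).contDiffOn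
  integrable t _ x₂ _ := integrable_mode h X A m t x₂
  smooth_fourier t _ η := by
    simp_rw [partialFourier_mode h]
    have e : ContDiff ℝ ∞ fun y : ℝ => (y : ℂ) := ofRealCLM.contDiff
    exact ContDiff.contDiffOn (by fun_prop)

theorem partialFourier_mode_eq_zero {η : ℝ} (hη : ¬ ((n : ℝ) ≤ |η| ∧ |η| ≤ n + 1))
    (t y : ℝ) : partialFourier (mode χ X A m t) η y = 0 := by
  have key (ξ : ℝ) (hξ : |ξ| = |η|) : χ ξ = 0 := by
    by_contra h0
    have h1 := h.band ξ h0
    rw [← hξ, abs_of_nonneg ((Nat.cast_nonneg n).trans h1.1)] at hη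
    exact hη h1
  rw [partialFourier_mode h, key η rfl, key (-η) (abs_neg η)]
  simp

/-- On the support of `χ`, a subset of the nonnegative frequencies, `η` and `|η|` agree. -/
theorem isNormalModeBulk_mode (s : Side) : IsNormalModeBulk X n s (mode χ X A m) := by
  intro t η y _ _
  constructor
  · have key (ξ : ℝ) (hξ : |ξ| = |η|) :
        (χ ξ : ℂ) * Real.exp (X * ξ * t) = Real.exp (X * |η| * t) * χ ξ := by
      by_cases h0 : χ ξ = 0
      · simp [h0]
      · rw [← hξ, abs_of_nonneg ((Nat.cast_nonneg n).trans (h.band ξ h0).1), mul_comm]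
    have h1 := key η rfl
    have h2 := key (-η) (abs_neg η)
    simp only [partialFourier_mode h, mul_zero, Real.exp_zero, ofReal_one, mul_one]
    linear_combination (Real.pi * A * exp (-(η * m) * y)) * h1
      + (Real.pi * conj A * exp (η * conj m * y)) * h2
  · intro h0
    by_contra hη
    exact h0 (partialFourier_mode_eq_zero h X A m hη t y)

end Calculus

/-! ### Sobolev norms of normal modes -/

section Norms

variable {n : ℕ} {a : ℝ} {χ : ℝ → ℝ} {X : ℝ} {A m : ℂ}

theorem sign_mul_eq_abs {s : Side} {y : ℝ} (hy : y ∈ s.halfLine) : s.sign * y = |y| := by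
  cases s
  · simp [Side.sign, abs_of_pos (show 0 < y from hy)]
  · simp [Side.sign, abs_of_neg (show y < 0 from hy)]

theorem measurableSet_halfLine (s : Side) : MeasurableSet s.halfLine := by
  cases s
  · exact measurableSet_Ioi
  · exact measurableSet_Iio

theorem lintegral_halfLine_exp (s : Side) {b : ℝ} (hb : 0 < b) :
    ∫⁻ y in s.halfLine, ENNReal.ofReal (Real.exp (-b * |y|)) = ENNReal.ofReal (1 / b) := by
  have e : ∫⁻ y in s.halfLine, ENNReal.ofReal (Real.exp (-b * |y|))
      = ∫⁻ y in s.halfLine, ENNReal.ofReal (Real.exp (-b * s.sign * y)) := by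
    refine setLIntegral_congr_fun (measurableSet_halfLine s) fun y hy => ?_
    simp only [← sign_mul_eq_abs hy, mul_assoc]
  rw [e]
  cases s
  · simp only [Side.sign, mul_one, Side.halfLine]
    rw [← ofReal_integral_eq_lintegral_ofReal
      (integrableOn_exp_mul_Ioi (by linarith) 0) (.of_forall fun _ => (Real.exp_pos _).le),
      integral_exp_mul_Ioi (by linarith)]
    simp
  · simp only [Side.sign, mul_neg, mul_one, neg_neg, Side.halfLine]
    rw [setLIntegral_congr Iio_ae_eq_Iic, ← ofReal_integral_eq_lintegral_ofReal
      (integrableOn_exp_mul_Iic hb 0) (.of_forall fun _ => (Real.exp_pos _).le),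
      integral_exp_mul_Iic hb]
    simp

/-- The set `n ≤ |η| ≤ n + 1` has measure at most `2`. -/
theorem lintegral_band_le {g : ℝ → ℝ≥0∞} {c : ℝ≥0∞}
    (h0 : ∀ η, ¬ ((n : ℝ) ≤ |η| ∧ |η| ≤ n + 1) → g η = 0)
    (h1 : ∀ η, (n : ℝ) ≤ |η| → |η| ≤ n + 1 → g η ≤ c) : ∫⁻ η, g η ≤ c * 2 := by
  set S : Set ℝ := Set.Icc (n : ℝ) (n + 1) ∪ Set.Icc (-(n + 1) : ℝ) (-n) with hS
  have hmem (η : ℝ) (hη : (n : ℝ) ≤ |η| ∧ |η| ≤ n + 1) : η ∈ S := by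
    rcases abs_cases η with ⟨e, _⟩ | ⟨e, _⟩ <;> rw [e] at hη
    · exact Or.inl hη
    · exact Or.inr ⟨by linarith, by linarith⟩
  have hvol : volume S ≤ 2 := by
    refine (measure_union_le _ _).trans ?_
    rw [Real.volume_Icc, Real.volume_Icc]
    have e1 : (n : ℝ) + 1 - n = 1 := by ring
    have e2 : -(n : ℝ) - -(n + 1) = 1 := by ring
    rw [e1, e2, ENNReal.ofReal_one]
    exact le_of_eq one_add_one_eq_two
  have hmeas : MeasurableSet S := measurableSet_Icc.union measurableSet_Icc
  calc ∫⁻ η, g η ≤ ∫⁻ η, S.indicator (fun _ => c) η := by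
        refine lintegral_mono fun η => ?_
        by_cases hη : (n : ℝ) ≤ |η| ∧ |η| ≤ n + 1
        · rw [Set.indicator_of_mem (hmem η hη)]
          exact h1 η hη.1 hη.2
        · rw [h0 η hη]; exact zero_le
    _ = c * volume S := by rw [lintegral_indicator hmeas, setLIntegral_const]
    _ ≤ c * 2 := by gcongr

theorem norm_iteratedDeriv_partialFourier_mode_le (h : IsBandProfile n a χ) (hn : 1 ≤ n)
    (hX : 0 ≤ X) (hm : ‖m‖ ≤ 1) {s : Side} (hp : 0 ≤ s.sign * m.re) {t : ℝ} (ht : 0 ≤ t)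
    (η : ℝ) (r : ℕ) {y : ℝ} (hy : y ∈ s.halfLine) :
    ‖iteratedDeriv r (fun y => partialFourier (mode χ X A m t) η y) y‖
      ≤ 2 * Real.pi * ‖A‖ * a * Real.exp (X * (n + 1) * t) * (n + 1) ^ r
        * Real.exp (-(s.sign * m.re) * |y|) := by
  have ha : 0 ≤ a := (abs_nonneg _).trans (h.bound 0)
  have hpi := Real.pi_pos
  have hre : m.re * y = (s.sign * m.re) * |y| := by
    rw [← sign_mul_eq_abs hy]
    cases s <;> simp [Side.sign]
  have key (ξ : ℝ) (hξ : |ξ| = |η|) (B w : ℂ) (hB : ‖B‖ = ‖A‖) (hw : ‖w‖ = |ξ| * ‖m‖) :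
      ‖Real.pi * B * χ ξ * Real.exp (X * ξ * t) * w ^ r‖ * Real.exp (-(ξ * m.re) * y)
        ≤ Real.pi * ‖A‖ * a * Real.exp (X * (n + 1) * t) * (n + 1) ^ r
          * Real.exp (-(s.sign * m.re) * |y|) := by
    by_cases h0 : χ ξ = 0
    · simp only [h0, ofReal_zero, mul_zero, zero_mul, norm_zero]
      positivity
    · obtain ⟨h1, h2⟩ := h.band ξ h0
      have hn' : (1 : ℝ) ≤ n := by exact_mod_cast hn
      have hpos : 0 ≤ ξ := by linarith
      simp only [norm_mul, norm_pow, hB, hw, norm_real, Real.norm_eq_abs, abs_of_pos hpi,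
        abs_of_pos (Real.exp_pos _), abs_of_nonneg hpos]
      have e1 : Real.exp (-(ξ * m.re) * y) ≤ Real.exp (-(s.sign * m.re) * |y|) := by
        apply Real.exp_le_exp.2
        have : -(ξ * m.re) * y = -(ξ * ((s.sign * m.re) * |y|)) := by rw [← hre]; ring
        rw [this]
        have : 0 ≤ (s.sign * m.re) * |y| := by positivity
        nlinarith
      have e2 : ξ * ‖m‖ ≤ n + 1 := by
        calc ξ * ‖m‖ ≤ ξ * 1 := by gcongr
          _ ≤ n + 1 := by linarith
      have e3 := h.bound ξ
      gcongr
  rw [iteratedDeriv_partialFourier_mode h]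
  refine (norm_add_le _ _).trans ?_
  rw [norm_mul _ (exp _), norm_mul _ (exp _), norm_exp, norm_exp]
  have k1 := key η rfl A (-(η * m)) rfl (by simp)
  have k2 := key (-η) (abs_neg η) (conj A) (η * conj m) (by simp) (by simp)
  have r1 : (-(η * m) * y : ℂ).re = -(η * m.re) * y := by simp
  have r2 : (η * conj m * y : ℂ).re = -(-η * m.re) * y := by simp
  rw [r1, r2]
  linarith

theorem one_add_sq_le {η : ℝ} (hη : |η| ≤ n + 1) : 1 + η ^ 2 ≤ 1 + ((n : ℝ) + 1) ^ 2 := by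
  rw [← sq_abs η]
  gcongr

/-- Each `x₂`-derivative costs one power of the frequency because `‖m‖ ≤ 1`, and the integral over the
half-line converges because frequencies in the band are at least `1`. -/
theorem sobolevSqSide_mode_le (h : IsBandProfile n a χ) (hn : 1 ≤ n)
    (hX : 0 ≤ X) (hm : ‖m‖ ≤ 1) {s : Side} (hp : 0 < s.sign * m.re) {t : ℝ} (ht : 0 ≤ t)
    (k : ℕ) :
    sobolevSqSide s k (mode χ X A m t) ≤ ENNReal.ofReal ((k + 1) * ((1 + ((n : ℝ) + 1) ^ 2) ^ k
      * (2 * Real.pi * ‖A‖ * a * Real.exp (X * (n + 1) * t)) ^ 2 * (1 / (s.sign * m.re)))) := by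
  set p := s.sign * m.re with hpdef
  set Y := 2 * Real.pi * ‖A‖ * a * Real.exp (X * (n + 1) * t) with hY
  set L := 1 + ((n : ℝ) + 1) ^ 2 with hL
  have hL0 : 0 ≤ L := by positivity
  have hterm (r : ℕ) (hr : r ∈ Finset.range (k + 1)) :
      ∫⁻ η : ℝ, ∫⁻ x₂ in s.halfLine, ENNReal.ofReal ((1 + η ^ 2) ^ (k - r)) *
        ‖iteratedDeriv r (fun y => partialFourier (mode χ X A m t) η y) x₂‖ₑ ^ 2
      ≤ ENNReal.ofReal (L ^ k * Y ^ 2 * (1 / p)) := by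
    have hrk : r ≤ k := Nat.lt_succ_iff.1 (Finset.mem_range.1 hr)
    have e : ENNReal.ofReal (L ^ k * Y ^ 2 * (1 / p))
        = ENNReal.ofReal (L ^ k * Y ^ 2) * ENNReal.ofReal (1 / (2 * p)) * 2 := by
      rw [← ENNReal.ofReal_mul (by positivity), ← ENNReal.ofReal_ofNat 2,
        ← ENNReal.ofReal_mul (by positivity)]
      congr 1
      field_simp
    rw [e]
    refine lintegral_band_le (n := n) (fun η hη => ?_) (fun η h1 h2 => ?_)
    · have e0 : (fun y => partialFourier (mode χ X A m t) η y) = fun _ => 0 :=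
        funext fun y => partialFourier_mode_eq_zero h X A m hη t y
      simp [e0, iteratedDeriv_fun_const_zero]
    · rw [← lintegral_halfLine_exp s (by positivity : 0 < 2 * p), ← lintegral_const_mul _
        (by fun_prop)]
      refine setLIntegral_mono_ae (by fun_prop) (.of_forall fun y hy => ?_)
      have hb := norm_iteratedDeriv_partialFourier_mode_le (A := A) h hn hX hm hp.le ht η r hy
      rw [← hY, ← hpdef] at hb
      rw [← ofReal_norm, ← ENNReal.ofReal_pow (norm_nonneg _),
        ← ENNReal.ofReal_mul (by positivity), ← ENNReal.ofReal_mul (by positivity)]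
      apply ENNReal.ofReal_le_ofReal
      calc (1 + η ^ 2) ^ (k - r)
            * ‖iteratedDeriv r (fun y => partialFourier (mode χ X A m t) η y) y‖ ^ 2
          ≤ L ^ (k - r) * (Y * (n + 1) ^ r * Real.exp (-p * |y|)) ^ 2 := by
            gcongr
            exact one_add_sq_le h2
        _ = L ^ (k - r) * (((n : ℝ) + 1) ^ 2) ^ r * Y ^ 2 * Real.exp (-(2 * p) * |y|) := by
            have : Real.exp (-(2 * p) * |y|) = Real.exp (-p * |y|) ^ 2 := by
              rw [← Real.exp_nat_mul]
              congr 1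
              push_cast
              ring
            rw [this, ← pow_mul, mul_comm 2 r, pow_mul]
            ring
        _ ≤ L ^ (k - r) * L ^ r * Y ^ 2 * Real.exp (-(2 * p) * |y|) := by
            gcongr
            linarith
        _ = _ := by rw [← pow_add, Nat.sub_add_cancel hrk]
  refine (Finset.sum_le_sum hterm).trans_eq ?_
  rw [Finset.sum_const, Finset.card_range, nsmul_eq_mul,
    ENNReal.ofReal_mul (p := (k : ℝ) + 1) (by positivity)]
  congr 1
  rw [← Nat.cast_succ, ENNReal.ofReal_natCast]

theorem fourier1_front (h : IsBandProfile n a χ) (t η : ℝ) :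
    fourier1 (fun x₁ => mode χ X 1 0 t x₁ 0) η
      = Real.pi * (χ η * Real.exp (X * η * t) + χ (-η) * Real.exp (X * -η * t)) := by
  have h1 := partialFourier_mode h X 1 0 t η 0
  rw [partialFourier] at h1
  rw [h1]
  simp
  ring

theorem fourier1_front_eq (h : IsBandProfile n a χ) (t η : ℝ) :
    fourier1 (fun x₁ => mode χ X 1 0 t x₁ 0) η
      = (Real.exp (X * |η| * t) : ℂ) * ((Real.pi * (χ η + χ (-η)) : ℝ) : ℂ) := by
  have key (ξ : ℝ) (hξ : |ξ| = |η|) :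
      (χ ξ : ℂ) * Real.exp (X * ξ * t) = Real.exp (X * |η| * t) * χ ξ := by
    by_cases h0 : χ ξ = 0
    · simp [h0]
    · rw [← hξ, abs_of_nonneg ((Nat.cast_nonneg n).trans (h.band ξ h0).1), mul_comm]
  rw [fourier1_front h, key η rfl, key (-η) (abs_neg η)]
  push_cast
  ring

theorem sobolevSqFront_mode_le (h : IsBandProfile n a χ) (hX : 0 ≤ X) {t : ℝ} (ht : 0 ≤ t)
    (k : ℕ) :
    sobolevSqFront k (fun x₁ => mode χ X 1 0 t x₁ 0)
      ≤ ENNReal.ofReal (2 * ((1 + ((n : ℝ) + 1) ^ 2) ^ k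
        * (2 * Real.pi * a * Real.exp (X * (n + 1) * t)) ^ 2)) := by
  have hpi := Real.pi_pos
  have ha : 0 ≤ a := (abs_nonneg _).trans (h.bound 0)
  rw [mul_comm (2 : ℝ), ENNReal.ofReal_mul (by positivity), ENNReal.ofReal_ofNat]
  refine lintegral_band_le (n := n) (fun η hη => ?_) (fun η h1 h2 => ?_)
  · have h0 := partialFourier_mode_eq_zero h X 1 0 hη t 0
    rw [partialFourier] at h0
    simp [h0]
  · rw [fourier1_front_eq h, ← ofReal_norm, ← ENNReal.ofReal_pow (norm_nonneg _),
        ← ENNReal.ofReal_mul (by positivity)]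
    apply ENNReal.ofReal_le_ofReal
    have e1 := one_add_sq_le h2
    have e2 : ‖(Real.exp (X * |η| * t) : ℂ) * ((Real.pi * (χ η + χ (-η)) : ℝ) : ℂ)‖
        ≤ 2 * Real.pi * a * Real.exp (X * (n + 1) * t) := by
      rw [norm_mul, norm_real, norm_real, Real.norm_eq_abs, Real.norm_eq_abs,
        abs_of_pos (Real.exp_pos _), abs_mul, abs_of_pos hpi]
      have e3 : |χ η + χ (-η)| ≤ 2 * a := by
        linarith [abs_add_le (χ η) (χ (-η)), h.bound η, h.bound (-η)]
      calc Real.exp (X * |η| * t) * (Real.pi * |χ η + χ (-η)|)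
          ≤ Real.exp (X * (n + 1) * t) * (Real.pi * (2 * a)) := by gcongr
        _ = _ := by ring
    gcongr

/-- Only the middle half of the band, where the profile equals its maximum `a`, is used; the loss in
measure is absorbed by the factor `π` from Fourier inversion. -/
theorem le_sobolevSqFront_mode (h : IsBandProfile n a χ) (hX : 0 ≤ X) {t : ℝ} (ht : 0 ≤ t)
    (hχ : ∀ η : ℝ, n + 1 / 4 ≤ η → η ≤ n + 3 / 4 → χ η = a) (k : ℕ) :
    ENNReal.ofReal ((a * Real.exp (X * n * t)) ^ 2)
      ≤ sobolevSqFront k (fun x₁ => mode χ X 1 0 t x₁ 0) := by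
  have hpi := Real.pi_gt_three
  have ha : 0 ≤ a := (abs_nonneg _).trans (h.bound 0)
  set S : Set ℝ := Set.Icc ((n : ℝ) + 1 / 4) (n + 3 / 4) with hS
  have hvol : volume S = ENNReal.ofReal (1 / 2) := by
    rw [Real.volume_Icc]
    congr 1
    ring
  calc ENNReal.ofReal ((a * Real.exp (X * n * t)) ^ 2)
      ≤ ENNReal.ofReal ((Real.pi * a * Real.exp (X * n * t)) ^ 2) * volume S := by
        rw [hvol, ← ENNReal.ofReal_mul (by positivity)]
        apply ENNReal.ofReal_le_ofReal
        have h1 : 0 ≤ (a * Real.exp (X * n * t)) ^ 2 := by positivity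
        have h2 : 1 ≤ Real.pi ^ 2 * (1 / 2) := by nlinarith
        calc (a * Real.exp (X * n * t)) ^ 2
            ≤ (Real.pi ^ 2 * (1 / 2)) * (a * Real.exp (X * n * t)) ^ 2 :=
              le_mul_of_one_le_left h1 h2
          _ = _ := by ring
    _ = ∫⁻ η in S, ENNReal.ofReal ((Real.pi * a * Real.exp (X * n * t)) ^ 2) := by
        rw [setLIntegral_const]
    _ ≤ ∫⁻ η in S, ENNReal.ofReal ((1 + η ^ 2) ^ k)
          * ‖fourier1 (fun x₁ => mode χ X 1 0 t x₁ 0) η‖ₑ ^ 2 := by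
        refine setLIntegral_mono_ae' measurableSet_Icc (.of_forall fun η hη => ?_)
        rw [fourier1_front_eq h, ← ofReal_norm, ← ENNReal.ofReal_pow (norm_nonneg _),
          ← ENNReal.ofReal_mul (by positivity)]
        apply ENNReal.ofReal_le_ofReal
        have hn0 : (0 : ℝ) ≤ n := Nat.cast_nonneg n
        have hη0 : 0 < η := by linarith [hη.1]
        have hneg : χ (-η) = 0 := by
          by_contra h0
          linarith [(h.band _ h0).1]
        rw [hneg, add_zero, hχ η hη.1 hη.2, norm_mul, norm_real, norm_real, Real.norm_eq_abs,
          Real.norm_eq_abs, abs_of_pos (Real.exp_pos _), abs_of_pos hη0,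
          abs_of_nonneg (by positivity : 0 ≤ Real.pi * a)]
        have e1 : (1 : ℝ) ≤ (1 + η ^ 2) ^ k := one_le_pow₀ (by nlinarith)
        have e2 : Real.pi * a * Real.exp (X * n * t) ≤ Real.exp (X * η * t) * (Real.pi * a) := by
          rw [mul_comm]
          gcongr
          linarith [hη.1]
        calc (Real.pi * a * Real.exp (X * n * t)) ^ 2
            ≤ 1 * (Real.exp (X * η * t) * (Real.pi * a)) ^ 2 := by rw [one_mul]; gcongr
          _ ≤ _ := by gcongr
    _ ≤ _ := setLIntegral_le_lintegral _ _

end Norms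

/-! ### Solutions of the linearized system -/

section Solution

theorem mode_add (χ : ℝ → ℝ) (X : ℝ) (A A' m : ℂ) (t x₁ x₂ : ℝ) :
    mode χ X A m t x₁ x₂ + mode χ X A' m t x₁ x₂ = mode χ X (A + A') m t x₁ x₂ := by
  simp only [mode, add_mul, add_re]

theorem ofReal_mul_mode (χ : ℝ → ℝ) (X r : ℝ) (A m : ℂ) (t x₁ x₂ : ℝ) :
    r * mode χ X A m t x₁ x₂ = mode χ X (r * A) m t x₁ x₂ := by
  simp only [mode, mul_assoc, re_ofReal_mul]

theorem mode_amplitude_zero (χ : ℝ → ℝ) (X : ℝ) (m : ℂ) (t x₁ x₂ : ℝ) :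
    mode χ X 0 m t x₁ x₂ = 0 := by
  simp [mode]

/-- On the interface the decay rate is irrelevant. -/
theorem mode_interface (χ : ℝ → ℝ) (X : ℝ) (A m m' : ℂ) (t x₁ : ℝ) :
    mode χ X A m t x₁ 0 = mode χ X A m' t x₁ 0 := by
  simp [mode]

/-- The dispersion relation, in real form: `m = p + i q` satisfies `Re m > 0`, `|m| = 1` and
`(X + i V)² + |B|² = c² (m² - 1)`. Conjugation gives the same relation on the lower side. -/
structure Dispersion (c V : ℝ) (B : Fin 2 → ℝ) (X p q : ℝ) : Prop where
  growth_pos : 0 < X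
  decay_pos : 0 < p
  norm_eq : p ^ 2 + q ^ 2 = 1
  re_eq : c ^ 2 * (p ^ 2 - q ^ 2) = c ^ 2 + X ^ 2 - V ^ 2 + (B 0 ^ 2 + B 1 ^ 2)
  im_eq : c ^ 2 * (p * q) = X * V

/-- The symbol `X + i s V` of the material derivative `∂ₜ + v̇₁ ∂₁`, per unit of frequency. -/
noncomputable def growth (V X : ℝ) (s : Side) : ℂ := X + I * s.sign * V

/-- The conjugate of `p + i s q`; it is also the inverse when `p² + q² = 1`. -/
noncomputable def decayConj (p q : ℝ) (s : Side) : ℂ := p - I * s.sign * q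

/-- The exponent `s (p + i s q)` of `mode`, the sign of the side included. -/
noncomputable def decay (p q : ℝ) (s : Side) : ℂ := s.sign * p + I * q

/-- Amplitudes of the two components of `v`. The second is forced by the kinematic condition
`v₂ = (∂ₜ + v̇₁ ∂₁) f`. -/
noncomputable def velocityAmplitude (V X p q : ℝ) (s : Side) (i : Fin 2) : ℂ :=
  ![-I * s.sign * growth V X s * decayConj p q s, growth V X s] i

/-- Amplitudes of `G i l`, namely `i s B_l` times the amplitude of `v i` divided by `growth V X s`. -/
noncomputable def deformationAmplitude (B : Fin 2 → ℝ) (p q : ℝ) (s : Side) (i l : Fin 2) : ℂ :=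
  ![B l * decayConj p q s, I * s.sign * B l] i

/-- The growing solution with front profile `χ`. The bulk fields carry one more power of the frequency
than the front, whence the weight `η χ(η)`. -/
noncomputable def normalModeFields (V : ℝ) (B : Fin 2 → ℝ) (X p q : ℝ) (χ : ℝ → ℝ) : Fields where
  f t x₁ := mode χ X 1 0 t x₁ 0
  h s := mode (fun η => η * χ η) X (2 * I * q) (decay p q s)
  v s i := mode (fun η => η * χ η) X (velocityAmplitude V X p q s i) (decay p q s)
  G s i l := mode (fun η => η * χ η) X (deformationAmplitude B p q s i l) (decay p q s)

variable {n : ℕ} {a : ℝ} {χ : ℝ → ℝ} {c V : ℝ} {B : Fin 2 → ℝ} {X p q : ℝ}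

theorem isNormalModeSuperposition_normalModeFields (h : IsBandProfile n a χ)
    (V : ℝ) (B : Fin 2 → ℝ) (X p q : ℝ) :
    IsNormalModeSuperposition X n (normalModeFields V B X p q χ) where
  front := by
    refine ⟨fun η => Real.pi * (χ η + χ (-η)),
      contDiff_const.mul (h.smooth.add (h.smooth.comp contDiff_neg)), fun η hη => ?_,
      fun t η _ => fourier1_front_eq h t η⟩
    have key (ξ : ℝ) (hξ : |ξ| = |η|) (h0 : χ ξ ≠ 0) : (n : ℝ) ≤ |η| ∧ |η| ≤ n + 1 := by
      have h1 := h.band ξ h0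
      rw [← hξ, abs_of_nonneg ((Nat.cast_nonneg n).trans h1.1)]
      exact h1
    by_cases h1 : χ η = 0
    · refine key (-η) (abs_neg η) fun h2 => hη ?_
      simp [h1, h2]
    · exact key η rfl h1
  bulk_h s := isNormalModeBulk_mode h.id_mul X _ _ s
  bulk_v s i := isNormalModeBulk_mode h.id_mul X _ _ s
  bulk_G s i l := isNormalModeBulk_mode h.id_mul X _ _ s

/-- The `n`-independent factor in the bound of the `H^k` norm of `normalModeFields`. -/
noncomputable def normBoundConst (V : ℝ) (B : Fin 2 → ℝ) (X p : ℝ) (k : ℕ) : ℝ :=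
  2 + 4 * ((k + 1) * (2 + |X| + |V| + |B 0| + |B 1|) ^ 2 * (1 / p))

theorem rpow_half_le {x : ℝ≥0∞} {w : ℝ} (hw : 0 ≤ w) (h : x ≤ ENNReal.ofReal (w ^ 2)) :
    x ^ (1 / 2 : ℝ) ≤ ENNReal.ofReal w := by
  refine (ENNReal.rpow_le_rpow h (by norm_num)).trans_eq ?_
  rw [ENNReal.ofReal_rpow_of_nonneg (by positivity) (by norm_num), ← Real.sqrt_eq_rpow,
    Real.sqrt_sq hw]

theorem Dispersion.norm_decayConj (hd : Dispersion c V B X p q) (s : Side) :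
    ‖decayConj p q s‖ = 1 := by
  rw [← sq_eq_sq₀ (norm_nonneg _) zero_le_one, ← normSq_eq_norm_sq, normSq_apply]
  have := hd.norm_eq
  cases s <;> simp [decayConj, Side.sign] <;> linear_combination this

theorem Dispersion.norm_decay (hd : Dispersion c V B X p q) (s : Side) :
    ‖decay p q s‖ = 1 := by
  rw [← sq_eq_sq₀ (norm_nonneg _) zero_le_one, ← normSq_eq_norm_sq, normSq_apply]
  have := hd.norm_eq
  cases s <;> simp [decay, Side.sign] <;> linear_combination this

theorem sign_mul_re_decay (p q : ℝ) (s : Side) : s.sign * (decay p q s).re = p := by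
  cases s <;> simp [decay, Side.sign]

theorem abs_sign (s : Side) : |s.sign| = 1 := by
  cases s <;> simp [Side.sign]

theorem norm_growth_le (V X : ℝ) (s : Side) : ‖growth V X s‖ ≤ |X| + |V| := by
  refine (norm_add_le _ _).trans_eq ?_
  simp [abs_sign]

theorem sobolevNorm_normalModeFields_le (hd : Dispersion c V B X p q) (h : IsBandProfile n a χ)
    (hn : 1 ≤ n) (k : ℕ) (l : Fin 2) {t : ℝ} (ht : 0 ≤ t) :
    (normalModeFields V B X p q χ).sobolevNorm k l t
      ≤ ENNReal.ofReal (4 * (normBoundConst V B X p k * (1 + ((n : ℝ) + 1) ^ 2) ^ (k + 1)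
        * (2 * Real.pi * a * Real.exp (X * (n + 1) * t)))) := by
  have ha : 0 ≤ a := (abs_nonneg _).trans (h.bound 0)
  have hpi := Real.pi_pos
  have hp := hd.decay_pos
  set A₀ := 2 + |X| + |V| + |B 0| + |B 1| with hA₀
  set L := 1 + ((n : ℝ) + 1) ^ 2 with hL
  have hL1 : 1 ≤ L := by rw [hL]; nlinarith [sq_nonneg ((n : ℝ) + 1)]
  set Y := 2 * Real.pi * a * Real.exp (X * (n + 1) * t) with hY
  have hY0 : 0 ≤ Y := by positivity
  set K := (k + 1) * A₀ ^ 2 * (1 / p) with hK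
  have hK0 : 0 ≤ K := by positivity
  have hD : normBoundConst V B X p k = 2 + 4 * K := rfl
  set D := normBoundConst V B X p k
  have hD1 : 1 ≤ D := by rw [hD]; linarith
  set R := L ^ (k + 1) * Y ^ 2 with hR
  have hR0 : 0 ≤ R := by positivity
  have hside (s : Side) (A : ℂ) (hA : ‖A‖ ≤ A₀) :
      sobolevSqSide s k (mode (fun η => η * χ η) X A (decay p q s) t)
        ≤ ENNReal.ofReal (K * R) := by
    refine (sobolevSqSide_mode_le h.id_mul hn hd.growth_pos.le (hd.norm_decay s).le
      (by rwa [sign_mul_re_decay]) ht k).trans (ENNReal.ofReal_le_ofReal ?_)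
    rw [sign_mul_re_decay]
    calc ((k : ℝ) + 1) * (L ^ k * (2 * Real.pi * ‖A‖ * ((n + 1) * a)
          * Real.exp (X * (n + 1) * t)) ^ 2 * (1 / p))
        = ((k : ℝ) + 1) * ‖A‖ ^ 2 * (1 / p) * (L ^ k * ((n : ℝ) + 1) ^ 2 * Y ^ 2) := by
          rw [hY]; ring
      _ ≤ ((k : ℝ) + 1) * A₀ ^ 2 * (1 / p) * (L ^ k * L * Y ^ 2) := by
          gcongr
          linarith
      _ = K * R := by rw [hK, hR]; ring
  have hbulk (A : Side → ℂ) (hA : ∀ s, ‖A s‖ ≤ A₀) :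
      sobolevSqBulk k (fun s => mode (fun η => η * χ η) X (A s) (decay p q s) t)
        ≤ ENNReal.ofReal (2 * K * R) := by
    refine (add_le_add (hside _ _ (hA _)) (hside _ _ (hA _))).trans_eq ?_
    rw [← ENNReal.ofReal_add (by positivity) (by positivity)]
    congr 1
    ring
  have hfinal {x : ℝ≥0∞} {b : ℝ} (hb : b ≤ D) (hx : x ≤ ENNReal.ofReal (b * R)) :
      x ^ (1 / 2 : ℝ) ≤ ENNReal.ofReal (D * L ^ (k + 1) * Y) := by
    refine rpow_half_le (by positivity) (hx.trans (ENNReal.ofReal_le_ofReal ?_))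
    have h1 : 1 ≤ D * L ^ (k + 1) := one_le_mul_of_one_le_of_one_le hD1 (one_le_pow₀ hL1)
    calc b * R ≤ D * R := by gcongr
      _ = 1 * (D * L ^ (k + 1)) * Y ^ 2 := by rw [hR]; ring
      _ ≤ (D * L ^ (k + 1)) * (D * L ^ (k + 1)) * Y ^ 2 := by gcongr
      _ = _ := by ring
  have hsum (A : Side → Fin 2 → ℂ) (hA : ∀ s i, ‖A s i‖ ≤ A₀) :
      ∑ i, sobolevSqBulk k (fun s => mode (fun η => η * χ η) X (A s i) (decay p q s) t)
        ≤ ENNReal.ofReal (4 * K * R) := by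
    rw [Fin.sum_univ_two]
    refine (add_le_add (hbulk _ fun s => hA s 0) (hbulk _ fun s => hA s 1)).trans_eq ?_
    rw [← ENNReal.ofReal_add (by positivity) (by positivity)]
    congr 1
    ring
  have hq : |q| ≤ 1 := by
    rw [← sq_le_one_iff_abs_le_one]
    nlinarith [hd.norm_eq]
  have hX0 := abs_nonneg X
  have hV0 := abs_nonneg V
  have hB0 := abs_nonneg (B 0)
  have hB1 := abs_nonneg (B 1)
  have hBl : |B l| ≤ |B 0| + |B 1| := by
    fin_cases l
    · exact le_add_of_nonneg_right hB1
    · exact le_add_of_nonneg_left hB0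
  have s1 : sobolevSqFront k ((normalModeFields V B X p q χ).f t) ≤ ENNReal.ofReal (2 * R) := by
    refine (sobolevSqFront_mode_le h hd.growth_pos.le ht k).trans (ENNReal.ofReal_le_ofReal ?_)
    rw [hR]
    gcongr
    exact Nat.le_succ k
  have s2 := hbulk (fun s => 2 * I * q) fun s => by
    simp only [norm_mul, norm_ofNat, norm_I, norm_real, Real.norm_eq_abs]
    linarith
  have s3 := hsum (fun s i => velocityAmplitude V X p q s i) fun s i => by
    have := norm_growth_le V X s
    fin_cases i <;>
      simp [velocityAmplitude, hd.norm_decayConj, abs_sign] <;> linarith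
  have s4 := hsum (fun s i => deformationAmplitude B p q s i l) fun s i => by
    fin_cases i <;>
      simp [deformationAmplitude, hd.norm_decayConj, abs_sign] <;> linarith
  refine (add_le_add (add_le_add (add_le_add (hfinal (by linarith) s1) (hfinal (by linarith) s2))
    (hfinal (by linarith) s3)) (hfinal (by linarith) s4)).trans_eq ?_
  have hW : 0 ≤ D * L ^ (k + 1) * Y := by positivity
  rw [← ENNReal.ofReal_add hW hW, ← ENNReal.ofReal_add (by positivity) hW,
    ← ENNReal.ofReal_add (by positivity) hW]
  congr 1
  ring

/-- All equations become identities between the amplitudes multiplying one transform; the momentum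
equations are the ones that use the dispersion relation. -/
theorem isSolution_normalModeFields (hd : Dispersion c V B X p q) (h : IsBandProfile n a χ)
    (hn : 1 ≤ n) : IsSolution c V B (normalModeFields V B X p q χ) where
  regular_f :=
    { smooth := by
        have h1 : ContDiff ℝ ∞ fun x : ℝ × ℝ => (x.1, x.2, (0 : ℝ)) := by fun_prop
        exact ((contDiff_mode h X 1 0).comp h1).contDiffOn
      integrable := fun t _ => integrable_mode h X 1 0 t 0 }
  regular_h s := isRegularBulk_mode h.id_mul X _ _ s
  regular_v s i := isRegularBulk_mode h.id_mul X _ _ s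
  regular_G s i l := isRegularBulk_mode h.id_mul X _ _ s
  finite_norm k l t ht := (sobolevNorm_normalModeFields_le hd h hn k l ht).trans_lt
    ENNReal.ofReal_lt_top
  mass s t x₁ x₂ _ _ := by
    simp only [normalModeFields, dt_mode h.id_mul, d1_mode h.id_mul, d2_mode h.id_mul,
      ofReal_mul_mode, mode_add]
    convert mode_amplitude_zero _ _ _ _ _ _ using 2
    cases s <;>
      simp [velocityAmplitude, growth, decay, decayConj, Side.sign] <;>
      grind [I_sq]
  momentum_one s t x₁ x₂ _ _ := by
    have e1 := congrArg ofReal hd.norm_eq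
    have e2 := congrArg ofReal hd.re_eq
    have e3 := congrArg ofReal hd.im_eq
    push_cast at e1 e2 e3
    simp only [normalModeFields, dt_mode h.id_mul, d1_mode h.id_mul, Fin.sum_univ_two,
      ofReal_mul_mode, mode_add]
    congr 1
    cases s <;>
      simp [velocityAmplitude, deformationAmplitude, growth, decayConj, Side.sign] <;>
      grind [I_sq]
  momentum_two s t x₁ x₂ _ _ := by
    have e1 := congrArg ofReal hd.norm_eq
    have e2 := congrArg ofReal hd.re_eq
    have e3 := congrArg ofReal hd.im_eq
    push_cast at e1 e2 e3
    simp only [normalModeFields, dt_mode h.id_mul, d1_mode h.id_mul, d2_mode h.id_mul,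
      Fin.sum_univ_two, ofReal_mul_mode, mode_add]
    congr 1
    cases s <;>
      simp [velocityAmplitude, deformationAmplitude, growth, decay, Side.sign] <;>
      grind [I_sq]
  deformation s i l t x₁ x₂ _ _ := by
    simp only [normalModeFields, dt_mode h.id_mul, d1_mode h.id_mul,
      ofReal_mul_mode, mode_add]
    congr 1
    fin_cases i <;> cases s <;>
      simp [velocityAmplitude, deformationAmplitude, growth, decayConj, Side.sign] <;>
      grind [I_sq]
  front s t x₁ _ := by
    have e1 := dt_mode h X 1 0 t x₁ 0
    have e2 := d1_mode h X 1 0 t x₁ 0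
    simp only [dt, d1] at e1 e2
    simp only [normalModeFields]
    rw [e1, e2, mode_interface _ _ _ (decay p q s) 0, eq_sub_iff_add_eq, ofReal_mul_mode,
      mode_add]
    congr 1
    simp [velocityAmplitude, growth]
    ring
  jump_h t x₁ _ := sub_eq_zero.2 (mode_interface _ _ _ _ _ _ _)
  jump_v t x₁ _ := by
    have e2 := d1_mode h X 1 0 t x₁ 0
    simp only [d1] at e2
    simp only [normalModeFields]
    rw [e2, mode_interface _ _ _ (decay p q .upper) 0, mode_interface _ _ _ (decay p q .lower) 0,
      sub_eq_iff_eq_add, ofReal_mul_mode, mode_add]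
    congr 1
    simp [velocityAmplitude, growth, Side.sign]
    ring
  boundary_G s l t x₁ _ := by
    have e2 := d1_mode h X 1 0 t x₁ 0
    simp only [d1] at e2
    simp only [normalModeFields]
    rw [e2, mode_interface _ _ _ (decay p q s) 0, sub_eq_zero, ofReal_mul_mode]
    congr 1
    simp [deformationAmplitude]
    ring

end Solution

/-! ### The dispersion relation -/

/-- The decay rate is the square root with positive real part of a unit complex number; the unit
modulus is the equation for `growthRate`, and the two bounds on `V²` make the rate positive and keep
that number off `-1`. -/
theorem exists_dispersion {c V : ℝ} {B : Fin 2 → ℝ} (hc : 0 < c)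
    (h1 : B 0 ^ 2 + B 1 ^ 2 < V ^ 2) (h2 : V ^ 2 < B 0 ^ 2 + B 1 ^ 2 + 2 * c ^ 2) :
    ∃ p q : ℝ, Dispersion c V B (growthRate c V B) p q := by
  set b := B 0 ^ 2 + B 1 ^ 2 with hb
  have hb0 : 0 ≤ b := by positivity
  set S := √(c ^ 4 + 4 * (b + c ^ 2) * V ^ 2) with hS
  have hS2 : S ^ 2 = c ^ 4 + 4 * (b + c ^ 2) * V ^ 2 := Real.sq_sqrt (by positivity)
  have hpos : 0 < S - V ^ 2 - b - c ^ 2 := by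
    have : V ^ 2 + b + c ^ 2 < S := by
      refine Real.lt_sqrt_of_sq_lt ?_
      nlinarith [mul_pos (sub_pos.2 h1) (sub_pos.2 h2)]
    linarith
  set X := growthRate c V B with hX
  have hXdef : X = √(S - V ^ 2 - b - c ^ 2) := rfl
  have hX0 : 0 < X := by rw [hXdef]; exact Real.sqrt_pos.2 hpos
  have hX2 : X ^ 2 = S - V ^ 2 - b - c ^ 2 := by rw [hXdef]; exact Real.sq_sqrt hpos.le
  have hc2 : 0 < c ^ 2 := by positivity
  set r := (c ^ 2 + X ^ 2 - V ^ 2 + b) / c ^ 2 with hr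
  have hrc : c ^ 2 * r = c ^ 2 + X ^ 2 - V ^ 2 + b := by rw [hr]; field_simp
  have hr1 : 0 < (1 + r) / 2 := by
    have : 0 < c ^ 2 * (1 + r) := by rw [mul_add, hrc]; nlinarith
    have := pos_of_mul_pos_right this hc2.le
    linarith
  -- The unit-modulus condition on the square of the decay rate is what fixes `X`.
  have hunit : 4 * (X * V) ^ 2 = (c ^ 2) ^ 2 * (1 - r ^ 2) := by
    have : c ^ 2 * r = S - 2 * V ^ 2 := by rw [hrc, hX2]; ring
    have h3 : (c ^ 2) ^ 2 * (1 - r ^ 2) = c ^ 4 - (c ^ 2 * r) ^ 2 := by ring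
    rw [h3, this, mul_pow, hX2]
    linear_combination hS2
  set p := √((1 + r) / 2) with hp
  have hp0 : 0 < p := Real.sqrt_pos.2 hr1
  have hp2 : p ^ 2 = (1 + r) / 2 := Real.sq_sqrt hr1.le
  have hq2 : (X * V / (c ^ 2 * p)) ^ 2 = (1 - r) / 2 := by
    rw [div_pow, mul_pow (c ^ 2), hp2, div_eq_iff (by positivity)]
    linear_combination hunit / 4
  refine ⟨p, X * V / (c ^ 2 * p), hX0, hp0, ?_, ?_, ?_⟩
  · rw [hp2, hq2]; ring
  · rw [hp2, hq2]; linear_combination hrc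
  · field_simp

/-- A bump of height `a` centred in the band `[n, n + 1]`. -/
noncomputable def bumpProfile (n : ℕ) (a : ℝ) (η : ℝ) : ℝ :=
  a * (⟨1 / 4, 1 / 2, by norm_num, by norm_num⟩ : ContDiffBump ((n : ℝ) + 1 / 2)) η

theorem isBandProfile_bumpProfile (n : ℕ) {a : ℝ} (ha : 0 ≤ a) :
    IsBandProfile n a (bumpProfile n a) where
  smooth := contDiff_const.mul (ContDiffBump.contDiff _)
  band η hη := by
    have h1 := right_ne_zero_of_mul hη
    rw [← Function.mem_support, ContDiffBump.support_eq, Metric.mem_ball, Real.dist_eq,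
      abs_lt] at h1
    constructor <;> linarith [h1.1, h1.2]
  bound η := by
    rw [bumpProfile, abs_mul, abs_of_nonneg ha, abs_of_nonneg (ContDiffBump.nonneg _)]
    exact mul_le_of_le_one_right ha (ContDiffBump.le_one _)

theorem bumpProfile_eq (n : ℕ) (a : ℝ) (η : ℝ) (h1 : n + 1 / 4 ≤ η) (h2 : η ≤ n + 3 / 4) :
    bumpProfile n a η = a := by
  rw [bumpProfile, ContDiffBump.one_of_mem_closedBall, mul_one]
  rw [Metric.mem_closedBall, Real.dist_eq, abs_le]
  constructor <;> simp only <;> linarith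

theorem le_sobolevNorm_normalModeFields {n : ℕ} {a : ℝ} {χ : ℝ → ℝ} {X t : ℝ}
    (h : IsBandProfile n a χ) (hX : 0 ≤ X) (ht : 0 ≤ t)
    (hχ : ∀ η : ℝ, n + 1 / 4 ≤ η → η ≤ n + 3 / 4 → χ η = a)
    (V : ℝ) (B : Fin 2 → ℝ) (p q : ℝ) (k : ℕ) (l : Fin 2) :
    ENNReal.ofReal (a * Real.exp (X * n * t))
      ≤ (normalModeFields V B X p q χ).sobolevNorm k l t := by
  have ha : 0 ≤ a := (abs_nonneg _).trans (h.bound 0)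
  have h1 := ENNReal.rpow_le_rpow (le_sobolevSqFront_mode h hX ht hχ k)
    (by norm_num : (0 : ℝ) ≤ 1 / 2)
  rw [ENNReal.ofReal_rpow_of_nonneg (by positivity) (by norm_num), ← Real.sqrt_eq_rpow,
    Real.sqrt_sq (by positivity)] at h1
  refine h1.trans ?_
  rw [Fields.sobolevNorm, add_assoc, add_assoc]
  exact le_self_add

/-- The amplitude for which the bound of `sobolevNorm_normalModeFields_le` at time `0` becomes `1 / n`,
where `D` stands for `normBoundConst`. -/
noncomputable def smallAmplitude (D : ℝ) (j n : ℕ) : ℝ :=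
  (4 * (D * (1 + ((n : ℝ) + 1) ^ 2) ^ (j + 1) * (2 * Real.pi)) * n)⁻¹

theorem eventually_le_smallAmplitude_mul_exp {D b : ℝ} (hD : 0 < D) (hb : 0 < b) (j : ℕ) (α : ℝ) :
    ∀ᶠ n : ℕ in Filter.atTop, α ≤ smallAmplitude D j n * Real.exp (b * n) := by
  have hpi := Real.pi_pos
  have h1 : Filter.Tendsto (fun n : ℕ => b * n) Filter.atTop Filter.atTop :=
    tendsto_natCast_atTop_atTop.const_mul_atTop hb
  have h2 := ((Real.tendsto_exp_div_pow_atTop (2 * j + 3)).comp h1).eventually_ge_atTop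
    (|α| * (4 * (D * 5 ^ (j + 1) * (2 * Real.pi))) / b ^ (2 * j + 3))
  filter_upwards [h2, Filter.eventually_ge_atTop 1] with n hn hn1
  have hn1' : (1 : ℝ) ≤ n := by exact_mod_cast hn1
  simp only [Function.comp] at hn
  rw [mul_pow, div_le_div_iff₀ (by positivity) (by positivity)] at hn
  have h3 : |α| * (4 * (D * 5 ^ (j + 1) * (2 * Real.pi))) * (n : ℝ) ^ (2 * j + 3)
      ≤ Real.exp (b * n) := by
    have : 0 < b ^ (2 * j + 3) := by positivity
    refine le_of_mul_le_mul_right ?_ this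
    linarith
  have h4 : 1 + ((n : ℝ) + 1) ^ 2 ≤ 5 * n ^ 2 := by nlinarith
  rw [smallAmplitude, inv_mul_eq_div, le_div_iff₀ (by positivity)]
  calc α * (4 * (D * (1 + ((n : ℝ) + 1) ^ 2) ^ (j + 1) * (2 * Real.pi)) * n)
      ≤ |α| * (4 * (D * (5 * (n : ℝ) ^ 2) ^ (j + 1) * (2 * Real.pi)) * n) := by
        gcongr
        exact le_abs_self α
    _ = |α| * (4 * (D * 5 ^ (j + 1) * (2 * Real.pi))) * (n : ℝ) ^ (2 * j + 3) := by ring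
    _ ≤ _ := h3

end KelvinHelmholtz

open KelvinHelmholtz in
theorem lemma4p3 (c : ℝ) (hc : 0 < c) (B : Fin 2 → ℝ) (ε₀ : ℝ) (hε₀ : 0 < ε₀) (j : ℕ) :
    ∃ C : ℝ, 0 < C ∧ ∀ V : ℝ,
      √((B 0 ^ 2 + B 1 ^ 2) / c ^ 2) + ε₀ ≤ |V| / c →
      |V| / c ≤ √(2 + (B 0 ^ 2 + B 1 ^ 2) / c ^ 2) - ε₀ →
      ∀ k : ℕ, k ≤ j → ∀ T₀ : ℝ, 0 < T₀ → ∀ α : ℝ, 0 < α →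
        ∃ U : ℕ → KelvinHelmholtz.Fields,
          (∀ n : ℕ, 1 ≤ n →
            KelvinHelmholtz.IsSolution c V B (U n) ∧
            (∀ l : Fin 2, (U n).sobolevNorm j l 0 ≤ ENNReal.ofReal (C / n)) ∧
            (∀ l : Fin 2, ∀ t : ℝ, T₀ ≤ t → ENNReal.ofReal α ≤ (U n).sobolevNorm k l t)) ∧
          ∃ N : ℕ, ∀ n : ℕ, N ≤ n →
            KelvinHelmholtz.IsNormalModeSuperposition
              (KelvinHelmholtz.growthRate c V B) n (U n) := by
  refine ⟨1, one_pos, fun V hlow hup k _ T₀ hT₀ α _ => ?_⟩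
  have hM : (|V| / c) ^ 2 = V ^ 2 / c ^ 2 := by rw [div_pow, sq_abs]
  have h1 : B 0 ^ 2 + B 1 ^ 2 < V ^ 2 := by
    have h : √((B 0 ^ 2 + B 1 ^ 2) / c ^ 2) < |V| / c := by linarith
    rw [Real.sqrt_lt' (by linarith [Real.sqrt_nonneg ((B 0 ^ 2 + B 1 ^ 2) / c ^ 2)]), hM] at h
    exact (div_lt_div_iff_of_pos_right (by positivity)).1 h
  have h2 : V ^ 2 < B 0 ^ 2 + B 1 ^ 2 + 2 * c ^ 2 := by
    have h : |V| / c < √(2 + (B 0 ^ 2 + B 1 ^ 2) / c ^ 2) := by linarith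
    rw [Real.lt_sqrt (by positivity), hM, div_lt_iff₀ (by positivity), add_mul,
      div_mul_cancel₀ _ (by positivity)] at h
    linarith
  obtain ⟨p, q, hd⟩ := exists_dispersion hc h1 h2
  set X := growthRate c V B
  have hp := hd.decay_pos
  have hX := hd.growth_pos
  set D := normBoundConst V B X p j with hD
  have hD0 : 0 < D := by rw [hD, normBoundConst]; positivity
  have hpi := Real.pi_pos
  obtain ⟨N, hN⟩ := Filter.eventually_atTop.1
    (eventually_le_smallAmplitude_mul_exp hD0 (mul_pos hX hT₀) j α)
  have ha (n : ℕ) : 0 ≤ smallAmplitude D j n := by rw [smallAmplitude]; positivity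
  -- For small `n` the solution of a larger index is used, which satisfies the stronger bound.
  let idx (n : ℕ) : ℕ := max n (max N 1)
  have hprof (n : ℕ) := isBandProfile_bumpProfile (idx n) (ha (idx n))
  have hidx (n : ℕ) : 1 ≤ idx n := (le_max_right N 1).trans (le_max_right _ _)
  refine ⟨fun n => normalModeFields V B X p q (bumpProfile (idx n) (smallAmplitude D j (idx n))),
    fun n hn => ⟨isSolution_normalModeFields hd (hprof n) (hidx n), fun l => ?_,
      fun l t ht => ?_⟩, max N 1, fun n hn => ?_⟩
  · refine (sobolevNorm_normalModeFields_le hd (hprof n) (hidx n) j l le_rfl).trans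
      (ENNReal.ofReal_le_ofReal ?_)
    rw [← hD, mul_zero, Real.exp_zero]
    have hn0 : (0 : ℝ) < n := by exact_mod_cast hn
    have hi0 : (0 : ℝ) < idx n := by exact_mod_cast hidx n
    calc 4 * (D * (1 + ((idx n : ℝ) + 1) ^ 2) ^ (j + 1)
          * (2 * Real.pi * smallAmplitude D j (idx n) * 1)) = 1 / (idx n : ℝ) := by
          rw [smallAmplitude]
          field_simp
      _ ≤ 1 / n := by
          gcongr
          exact le_max_left _ _
  · refine le_trans (ENNReal.ofReal_le_ofReal ?_)
      (le_sobolevNorm_normalModeFields (hprof n) hX.le (hT₀.le.trans ht)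
        (fun η h1 h2 => bumpProfile_eq _ _ η h1 h2) V B p q k l)
    refine (hN (idx n) ((le_max_left N 1).trans (le_max_right _ _))).trans ?_
    have := ha (idx n)
    rw [mul_right_comm]
    gcongr
  · have h := isNormalModeSuperposition_normalModeFields (hprof n) V B X p q
    have hi : idx n = n := max_eq_left hn
    simp only [hi] at h ⊢
    exact h
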